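/- Let $n,c\ge 1$, and write coordinates of $\mathbb{C}^{n+c}$ as $(z,w)$ with $z\in\mathbb{C}^n$ and $w=u+\sqrt{-1}\,v\in\mathbb{C}^c$, $u,v\in\mathbb{R}^c$. Let $M^{2n+c}\subset\mathbb{C}^{n+c}$ be a real-analytic CR-generic submanifold of real codimension $c$ (that is, $T_pM+\sqrt{-1}\,T_pM=T_p\mathbb{C}^{n+c}$ for every $p\in M$) with $0\in M$ and $T_0M=\{v=0\}$. Then there exists a local biholomorphism of $\mathbb{C}^{n+c}$, defined near the origin and fixing it, of the form $$z_k\longmapsto z_k\quad(1\le k\le n),\qquad w_l\longmapsto w_l(z,w)\quad(1\le l\le c),$$ such that the image $M'$ of (the germ at $0$ of) $M$ has the following properties. 1. Near the origin, in the new coordinates again denoted $(z,w)$, $M'$ is a graph $v=\varphi(z,\bar z,u)$, where $\varphi$ is an $\mathbb{R}^c$-valued real-analytic map with $\varphi(0)=0$. Let $\varphi(z,\underline z,\nu)$ denote its complexification, the $\mathbb{C}^c$-valued holomorphic germ at $0$ in the independent complex variables $(z,\underline z,\nu)\in\mathbb{C}^{n+n+c}$ that restricts to $\varphi(z,\bar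 z,u)$ for $\underline z=\bar z$ and $\nu=u$ real. Then, identically near $0$, $$0\equiv\varphi(z,0,\nu)\equiv\varphi(0,\underline z,\nu),$$ in particular $0\equiv\varphi(z,0,u)\equiv\varphi(0,\bar z,u)$; that is, all pluriharmonic terms are removed. 2. Let $\Theta(z,\underline z,\underline w)$ be the complex defining function of $M'$, that is, the $\mathbb{C}^c$-valued holomorphic germ at $0$ with $\Theta(0)=0$ obtained by solving $\frac{w-\underline w}{2\sqrt{-1}}=\varphi\big(z,\underline z,\frac{w+\underline w}{2}\big)$ for $w=\Theta(z,\underline z,\underline w)$. Near the origin, $M'$ is given by $w=\Theta(z,\bar z,\bar w)$. Let $\overline\Theta$ be the conjugate series, $\overline\Theta(t):=\overline{\Theta(\bar t)}$. Then, identically near $0$, $$\underline w\equiv\Theta(0,\underline z,\underline w)\equiv\Theta(z,0,\underline w),\qquad w\equiv\overline\Theta(0,z,w)\equiv\overline\Theta(\underline z,0,w).$$ -/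

import Mathlib

open Filter Topology

/-- `M` is an embedded real-analytic submanifold of codimension `k` of the real normed space `E`:
near each of its points it is the zero set of a real-analytic submersion onto `ℝᵏ`. -/
def IsRealAnalyticSubmanifold {E : Type*} [NormedAddCommGroup E] [NormedSpace ℝ E]
    (k : ℕ) (M : Set E) : Prop :=
  ∀ p ∈ M, ∃ (U : Set E) (ρ : E → (Fin k → ℝ)), IsOpen U ∧ p ∈ U ∧ AnalyticOnNhd ℝ ρ U ∧
    (∀ x ∈ U, Function.Surjective (fderiv ℝ ρ x)) ∧ ∀ x ∈ U, x ∈ M ↔ ρ x = 0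

/-- The tangent space `T_p M`: velocities at `p` of the curves drawn in `M`. -/
def tangentVectors {E : Type*} [NormedAddCommGroup E] [NormedSpace ℝ E]
    (M : Set E) (p : E) : Set E :=
  {v | ∃ γ : ℝ → E, γ 0 = p ∧ (∀ᶠ t in 𝓝 (0 : ℝ), γ t ∈ M) ∧ HasDerivAt γ v 0}

/-- `ℂⁿ⁺ᶜ` with coordinates `(z, w)`, `z ∈ ℂⁿ`, `w ∈ ℂᶜ`. -/
abbrev CSpace (n c : ℕ) : Type := (Fin n → ℂ) × (Fin c → ℂ)

/-- A real-analytic CR-generic submanifold `M²ⁿ⁺ᶜ ⊂ ℂⁿ⁺ᶜ`, of real codimension `c`: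
`T_p M + i T_p M = T_p ℂⁿ⁺ᶜ` at each point `p` of `M`. -/
structure IsCRGeneric {n c : ℕ} (M : Set (CSpace n c)) : Prop where
  submanifold : IsRealAnalyticSubmanifold c M
  generic : ∀ p ∈ M, ∀ x : CSpace n c,
    ∃ a ∈ tangentVectors M p, ∃ b ∈ tangentVectors M p, x = a + Complex.I • b

/-- A local biholomorphism defined near the origin and fixing it. -/
structure IsLocalBiholomorphismAtZero {E : Type*} [NormedAddCommGroup E] [NormedSpace ℂ E]
    (h : OpenPartialHomeomorph E E) : Prop where
  zero_mem : (0 : E) ∈ h.source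
  map_zero : h 0 = 0
  holomorphic : DifferentiableOn ℂ h h.source
  holomorphic_symm : DifferentiableOn ℂ h.symm h.target

/-- Near the origin, `M` is the graph `v = φ(z, u)` of the real-analytic map `φ`, where
`w = u + i v`. (As a function of `z`, `φ` is real-analytic: it depends on `z` and `z̄`.) -/
structure IsGraphingFunction {n c : ℕ} (M : Set (CSpace n c))
    (φ : (Fin n → ℂ) × (Fin c → ℝ) → (Fin c → ℝ)) : Prop where
  analytic : AnalyticAt ℝ φ 0
  map_zero : φ 0 = 0
  mem_iff : ∀ᶠ x : CSpace n c in 𝓝 0,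
    x ∈ M ↔ (fun l => (x.2 l).im) = φ (x.1, fun l => (x.2 l).re)

/-- `Φ(z, z̲, ν)` is the complexification of `φ`: a holomorphic germ in the `2n + c` independent
complex variables `(z, z̲, ν)` with `Φ(z, z̄, u) = φ(z, u)` for real `u`. In other words the power
series of `Φ` is that of `φ` in powers of `z`, `z̄`, `u`, with `z̄` and `u` replaced by `z̲`, `ν`. -/
structure IsComplexification {n c : ℕ} (φ : (Fin n → ℂ) × (Fin c → ℝ) → (Fin c → ℝ))
    (Φ : (Fin n → ℂ) × (Fin n → ℂ) × (Fin c → ℂ) → (Fin c → ℂ)) : Prop where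
  analytic : AnalyticAt ℂ Φ 0
  eq_on_diagonal : ∀ᶠ q : (Fin n → ℂ) × (Fin c → ℝ) in 𝓝 0,
    Φ (q.1, star q.1, fun l => (q.2 l : ℂ)) = fun l => (φ q l : ℂ)

/-- `Θ(z, z̲, w̲)` is the holomorphic germ vanishing at `0` obtained by solving
`(w - w̲) / (2i) = Φ(z, z̲, (w + w̲) / 2)` for `w`. -/
structure IsComplexDefiningFunction {n c : ℕ}
    (Φ Θ : (Fin n → ℂ) × (Fin n → ℂ) × (Fin c → ℂ) → (Fin c → ℂ)) : Prop where
  analytic : AnalyticAt ℂ Θ 0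
  map_zero : Θ 0 = 0
  solves : ∀ᶠ q : (Fin n → ℂ) × (Fin n → ℂ) × (Fin c → ℂ) in 𝓝 0,
    (2 * Complex.I)⁻¹ • (Θ q - q.2.2) = Φ (q.1, q.2.1, (2 : ℂ)⁻¹ • (Θ q + q.2.2))

/-- The conjugate series `Θ̄(t) = conj (Θ (conj t))`: only the coefficients are conjugated. -/
def conjSeries {E F : Type*} [Star E] [Star F] (Θ : E → F) : E → F :=
  fun t => star (Θ (star t))

/-! Replace `M` by its complexification: an equation `R(z, z̲, w, w̲) = 0` in independent variables,
invariant under the conjugation fixing the diagonal `z̲ = z̄`, `w̲ = w̄`, with linear part `(w -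
w̲)/(2i)`. By the implicit function theorem it can be solved for `v` (giving `Φ`) or for `w` (giving
`Θ`), and local uniqueness of these solutions carries the whole argument.

Every required identity says that the points `(z, 0, w, w)` and `(0, z̲, w, w)` satisfy the
equation: there `v = 0` and `w = w̲`, so uniqueness forces `Φ = 0` and `Θ = w̲`. The second family
follows from the first by conjugation.

To arrange the first family, parametrize the slice `z = z̲ = 0` by `w = ν + iΦ(0,0,ν)`, `w̲ = ν -
iΦ(0,0,ν)`, and move along `z̲ = 0` by solving for `w`: set `G(z, ν) = Θ(z, 0, ν - iΦ(0,0,ν))`.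
Since `Φ(0,0,·)` has real coefficients, `Ḡ(0, ν) = ν - iΦ(0,0,ν)`, so substituting `w = G(z, w')`,
`w̲ = Ḡ(z̲, w̲')` makes `(z, 0, ν, ν)` a solution (`exists_normalizingChange`). As `G` has linear
part `w`, the map `(z, w') ↦ (z, G)` is locally invertible, and its inverse is the required
biholomorphism. -/

/-! ### Holomorphic extension of real-analytic germs -/

/-- The power series with complex variables which has the same coefficients as the power series
`p` with real variables. -/
noncomputable def FormalMultilinearSeries.complexify {ι F : Type*} [Fintype ι]
    [NormedAddCommGroup F] [NormedSpace ℝ F] [NormedSpace ℂ F]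
    (p : FormalMultilinearSeries ℝ (ι → ℝ) F) : FormalMultilinearSeries ℂ (ι → ℂ) F := by
  classical
  exact fun n => ∑ s : Fin n → ι,
    ((ContinuousMultilinearMap.mkPiAlgebra ℂ (Fin n) ℂ).compContinuousLinearMap fun j => ContinuousLinearMap.proj (R := ℂ) (φ := fun _ : ι => ℂ) (s j)).smulRight
      (p n fun j => Pi.single (s j) 1)

section Complexify

variable {ι F : Type*} [Fintype ι] [NormedAddCommGroup F] [NormedSpace ℝ F] [NormedSpace ℂ F]

theorem FormalMultilinearSeries.complexify_apply_ofReal [IsScalarTower ℝ ℂ F]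
    (p : FormalMultilinearSeries ℝ (ι → ℝ) F) (n : ℕ) (x : ι → ℝ) :
    (p.complexify n fun _ => fun i => (x i : ℂ)) = p n fun _ => x := by
  classical
  have hx : (fun _ : Fin n => x) = fun _ => ∑ i, x i • (Pi.single i (1 : ℝ) : ι → ℝ) := by
    funext _
    exact pi_eq_sum_univ' x
  rw [hx]
  have := (p n).toMultilinearMap.map_sum
    (fun (_ : Fin n) (i : ι) => x i • (Pi.single i (1 : ℝ) : ι → ℝ))
  simp only [ContinuousMultilinearMap.coe_coe] at this
  rw [this]
  simp only [complexify, _root_.sum_apply, ContinuousMultilinearMap.smulRight_apply,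
    ContinuousMultilinearMap.compContinuousLinearMap_apply, ContinuousLinearMap.proj_apply,
    ContinuousMultilinearMap.mkPiAlgebra_apply]
  refine Finset.sum_congr rfl fun s _ => ?_
  rw [ContinuousMultilinearMap.map_smul_univ, ← Complex.ofReal_prod]
  rw [← Complex.coe_algebraMap, algebraMap_smul]

/-- There are `card ι ^ n` monomials, each of norm at most one, and their coefficients are values of
`p n` on unit vectors. -/
theorem FormalMultilinearSeries.norm_complexify_le
    (p : FormalMultilinearSeries ℝ (ι → ℝ) F) (n : ℕ) :
    ‖p.complexify n‖ ≤ (Fintype.card ι : ℝ) ^ n * ‖p n‖ := by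
  classical
  refine (norm_sum_le _ _).trans ?_
  have hcard : ((Finset.univ : Finset (Fin n → ι)).card : ℝ) = (Fintype.card ι : ℝ) ^ n := by
    simp
  rw [← hcard, ← nsmul_eq_mul]
  refine Finset.sum_le_card_nsmul _ _ _ fun s _ => ?_
  rw [ContinuousMultilinearMap.norm_smulRight]
  have h1 : ‖(ContinuousMultilinearMap.mkPiAlgebra ℂ (Fin n) ℂ).compContinuousLinearMap
      fun j => ContinuousLinearMap.proj (R := ℂ) (φ := fun _ : ι => ℂ) (s j)‖ ≤ 1 := by
    refine ContinuousMultilinearMap.opNorm_le_bound zero_le_one fun m => ?_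
    rw [one_mul, ContinuousMultilinearMap.compContinuousLinearMap_apply,
      ContinuousMultilinearMap.mkPiAlgebra_apply, norm_prod]
    exact Finset.prod_le_prod (fun _ _ => norm_nonneg _) fun j _ => norm_le_pi_norm (m j) (s j)
  have h2 : ‖p n fun j => (Pi.single (s j) (1 : ℝ) : ι → ℝ)‖ ≤ ‖p n‖ := by
    refine ((p n).le_opNorm _).trans (mul_le_of_le_one_right (norm_nonneg _) ?_)
    refine Finset.prod_le_one (fun _ _ => norm_nonneg _) fun j _ => ?_
    refine (pi_norm_le_iff_of_nonneg zero_le_one).2 fun i => ?_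
    by_cases h : i = s j
    · subst h; simp
    · simp [h]
  exact (mul_le_mul h1 h2 (norm_nonneg _) zero_le_one).trans_eq (one_mul _)

theorem FormalMultilinearSeries.radius_complexify_pos
    (p : FormalMultilinearSeries ℝ (ι → ℝ) F) (hp : 0 < p.radius) : 0 < p.complexify.radius := by
  obtain ⟨r, hr0, hr⟩ := ENNReal.lt_iff_exists_nnreal_btwn.1 hp
  obtain ⟨C, -, hC⟩ := p.norm_mul_pow_le_of_lt_radius hr
  have hr0 : 0 < r := by exact_mod_cast hr0
  -- The added 1 keeps `N` positive when `ι` is empty.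
  let N : NNReal := Fintype.card ι + 1
  have hN : 0 < N := by positivity
  refine lt_of_lt_of_le (b := ((r / N : NNReal) : ENNReal)) (by exact_mod_cast div_pos hr0 hN)
    (p.complexify.le_radius_of_bound C fun n => ?_)
  refine le_trans ?_ (hC n)
  have hN' : (0 : ℝ) < N := by exact_mod_cast hN
  have hle : (Fintype.card ι : ℝ) ≤ N := by simp [N]
  calc ‖p.complexify n‖ * ((r / N : NNReal) : ℝ) ^ n
      ≤ ((N : ℝ) ^ n * ‖p n‖) * ((r / N : NNReal) : ℝ) ^ n := by
        gcongr
        exact (p.norm_complexify_le n).trans (by gcongr)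
    _ = ‖p n‖ * (r : ℝ) ^ n := by
        rw [NNReal.coe_div, div_pow]
        field_simp

/-- A real-analytic germ extends to a holomorphic germ. -/
theorem AnalyticAt.exists_holomorphic_extension [IsScalarTower ℝ ℂ F] [CompleteSpace F]
    {f : (ι → ℝ) → F} (hf : AnalyticAt ℝ f 0) :
    ∃ g : (ι → ℂ) → F, AnalyticAt ℂ g 0 ∧ ∀ᶠ x in 𝓝 0, g (fun i => (x i : ℂ)) = f x := by
  obtain ⟨p, r, hp⟩ := hf
  refine ⟨p.complexify.sum, (p.complexify.hasFPowerSeriesOnBall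
    (p.radius_complexify_pos (hp.r_pos.trans_le hp.r_le))).analyticAt, ?_⟩
  filter_upwards [Metric.eball_mem_nhds (0 : ι → ℝ) hp.r_pos] with x hx
  have := hp.hasSum hx
  rw [zero_add] at this
  rw [FormalMultilinearSeries.sum, ← this.tsum_eq]
  exact tsum_congr fun n => p.complexify_apply_ofReal n x

end Complexify

/-! ### Conjugate power series -/

section Conj

variable {E F : Type*} [NormedAddCommGroup E] [NormedSpace ℂ E] [StarAddMonoid E]
  [NormedStarGroup E] [StarModule ℂ E] [NormedAddCommGroup F] [NormedSpace ℂ F] [StarAddMonoid F]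
  [NormedStarGroup F] [StarModule ℂ F]

/-- The power series with conjugate coefficients. -/
noncomputable def FormalMultilinearSeries.conj (p : FormalMultilinearSeries ℂ E F) :
    FormalMultilinearSeries ℂ E F := fun n =>
  MultilinearMap.mkContinuous
    { toFun := fun m => star (p n fun i => star (m i))
      map_update_add' := fun m i x y => by
        simp only [Function.apply_update (fun _ => star), star_add,
          ContinuousMultilinearMap.map_update_add]
      map_update_smul' := fun m i c x => by
        simp only [Function.apply_update (fun _ => star), star_smul,
          ContinuousMultilinearMap.map_update_smul, star_star] }
    ‖p n‖ fun m => by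
      refine (norm_star _).trans_le (((p n).le_opNorm _).trans_eq ?_)
      simp only [norm_star]

theorem FormalMultilinearSeries.norm_conj_le (p : FormalMultilinearSeries ℂ E F) (n : ℕ) :
    ‖p.conj n‖ ≤ ‖p n‖ :=
  MultilinearMap.mkContinuous_norm_le _ (norm_nonneg _) _

theorem FormalMultilinearSeries.radius_le_radius_conj (p : FormalMultilinearSeries ℂ E F) :
    p.radius ≤ p.conj.radius :=
  FormalMultilinearSeries.radius_le_of_le fun n => p.norm_conj_le n

/-- Conjugation is a continuous additive isometry, so it preserves the ball of convergence and
passes through the sum term by term. -/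
theorem analyticAt_conjSeries {f : E → F} (hf : AnalyticAt ℂ f 0) :
    AnalyticAt ℂ (conjSeries f) 0 := by
  obtain ⟨p, r, hp⟩ := hf
  refine ⟨p.conj, r, hp.r_le.trans p.radius_le_radius_conj, hp.r_pos, fun {y} hy => ?_⟩
  have hy' : star y ∈ Metric.eball (0 : E) r := by
    simpa [Metric.mem_eball, edist_zero_right, ← ofReal_norm] using hy
  have := hp.hasSum hy'
  rw [zero_add] at this ⊢
  exact this.star

end Conj

/-! ### Implicit functions -/

theorem ContinuousAt.tendsto_zero {X Y : Type*} [TopologicalSpace X] [TopologicalSpace Y] [Zero X]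
    [Zero Y] {f : X → Y} (hf : ContinuousAt f 0) (h0 : f 0 = 0) : Tendsto f (𝓝 0) (𝓝 0) := by
  simpa only [ContinuousAt, h0] using hf

/-- The analytic implicit function theorem for an equation with linear part `y - ℓ x`. -/
theorem AnalyticAt.exists_implicitFunction {X Y : Type*} [NormedAddCommGroup X] [NormedSpace ℂ X]
    [CompleteSpace X] [NormedAddCommGroup Y] [NormedSpace ℂ Y] [CompleteSpace Y]
    {f : X × Y → Y} (hf : AnalyticAt ℂ f 0) (hf0 : f 0 = 0) {ℓ : X →L[ℂ] Y}
    (hf' : HasFDerivAt f (.snd ℂ X Y - ℓ ∘L .fst ℂ X Y) 0) :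
    ∃ g : X → Y, AnalyticAt ℂ g 0 ∧ g 0 = 0 ∧ HasFDerivAt g ℓ 0 ∧
      ∀ᶠ q : X × Y in 𝓝 0, f q = 0 ↔ q.2 = g q.1 := by
  -- The exponent `⊤` of `WithTop ℕ∞` is analyticity, so the implicit function obtained is analytic.
  have hω : (⊤ : WithTop ℕ∞) ≠ 0 := by simp
  have hc : ContDiffAt ℂ (⊤ : WithTop ℕ∞) f 0 := hf.contDiffAt
  have hr : fderiv ℂ f 0 ∘L .inr ℂ X Y = .id ℂ Y := by
    rw [hf'.fderiv]; ext; simp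
  have hl : fderiv ℂ f 0 ∘L .inl ℂ X Y = -ℓ := by
    rw [hf'.fderiv]; ext; simp
  have hi : (fderiv ℂ f 0 ∘L .inr ℂ X Y).IsInvertible :=
    ⟨ContinuousLinearEquiv.refl ℂ Y, by rw [hr]; rfl⟩
  refine ⟨hc.implicitFunction hω hi, (hc.contDiffAt_implicitFunction hω hi).analyticAt,
    hc.implicitFunction_apply_self hω hi, ?_, ?_⟩
  · have := (hc.hasStrictFDerivAt_implicitFunction hω hi).hasFDerivAt
    rwa [hl, hr, ContinuousLinearMap.inverse_id, ContinuousLinearMap.id_comp, neg_neg] at this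
  · filter_upwards [hc.eventually_apply_eq_iff_implicitFunction hω hi] with q hq
    rw [hf0] at hq
    exact hq.trans eq_comm

/-! ### Solving the complexified equation -/

/-- The complexification of `ℂⁿ⁺ᶜ`, with independent coordinates `(z, z̲, w, w̲)`. -/
abbrev CSpace₂ (n c : ℕ) : Type :=
  (Fin n → ℂ) × (Fin n → ℂ) × (Fin c → ℂ) × (Fin c → ℂ)

/-- The linear form `(w - w̲) / (2i)`. -/
noncomputable def imForm (n c : ℕ) : CSpace₂ n c →L[ℂ] (Fin c → ℂ) :=
  (2 * Complex.I)⁻¹ •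
    ((ContinuousLinearMap.fst ℂ _ _ ∘L .snd ℂ _ _ ∘L .snd ℂ _ _) -
      (ContinuousLinearMap.snd ℂ _ _ ∘L .snd ℂ _ _ ∘L .snd ℂ _ _))

@[simp]
theorem imForm_apply {n c : ℕ} (x : CSpace₂ n c) :
    imForm n c x = (2 * Complex.I)⁻¹ • (x.2.2.1 - x.2.2.2) := rfl

/-- The embedding of `ℂⁿ⁺ᶜ` in its complexification as the set `z̲ = z̄`, `w̲ = w̄`. -/
def diagonal {n c : ℕ} (x : CSpace n c) : CSpace₂ n c := (x.1, star x.1, x.2, star x.2)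

/-- A complexified equation, with real values on the diagonal, and linear part `(w - w̲) / (2i)`. -/
structure IsNormalizedEquation {n c : ℕ} (R : CSpace₂ n c → (Fin c → ℂ)) : Prop where
  analytic : AnalyticAt ℂ R 0
  map_zero : R 0 = 0
  hasFDerivAt : HasFDerivAt R (imForm n c) 0
  conj : ∀ z z' w w', R (star z', star z, star w', star w) = star (R (z, z', w, w'))

namespace IsNormalizedEquation

variable {n c : ℕ} {R : CSpace₂ n c → (Fin c → ℂ)}

/-- Solving the equation for `v`, where `w = ν + i v` and `w̲ = ν - i v`. -/
theorem exists_graphing (hR : IsNormalizedEquation R) :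
    ∃ Φ : (Fin n → ℂ) × (Fin n → ℂ) × (Fin c → ℂ) → (Fin c → ℂ),
      AnalyticAt ℂ Φ 0 ∧ Φ 0 = 0 ∧ HasFDerivAt Φ (0 : _ →L[ℂ] (Fin c → ℂ)) 0 ∧
      ∀ᶠ q : ((Fin n → ℂ) × (Fin n → ℂ) × (Fin c → ℂ)) × (Fin c → ℂ) in 𝓝 0,
        R (q.1.1, q.1.2.1, q.1.2.2 + Complex.I • q.2, q.1.2.2 - Complex.I • q.2) = 0 ↔
          q.2 = Φ q.1 := by
  let T : ((Fin n → ℂ) × (Fin n → ℂ) × (Fin c → ℂ)) × (Fin c → ℂ) →L[ℂ] CSpace₂ n c :=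
    LinearMap.toContinuousLinearMap
    { toFun := fun q =>
        (q.1.1, q.1.2.1, q.1.2.2 + Complex.I • q.2, q.1.2.2 - Complex.I • q.2)
      map_add' := fun x y => by ext <;> simp <;> ring
      map_smul' := fun a x => by ext <;> simp <;> ring }
  refine AnalyticAt.exists_implicitFunction (f := R ∘ T) ?_ ?_ ?_
  · exact AnalyticAt.comp_of_eq hR.analytic (T.analyticAt 0) (_root_.map_zero T)
  · simp [hR.map_zero]
  · have h : HasFDerivAt R (imForm n c) (T 0) := by rw [_root_.map_zero]; exact hR.hasFDerivAt
    refine (h.comp 0 T.hasFDerivAt).congr_fderiv ?_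
    refine ContinuousLinearMap.ext fun q => ?_
    have : (T q) = (q.1.1, q.1.2.1, q.1.2.2 + Complex.I • q.2, q.1.2.2 - Complex.I • q.2) := rfl
    simp only [ContinuousLinearMap.comp_apply, this, imForm_apply]
    ext l
    simp
    ring_nf
    simp

/-- Solving the equation for `w`. -/
theorem exists_defining (hR : IsNormalizedEquation R) :
    ∃ Θ : (Fin n → ℂ) × (Fin n → ℂ) × (Fin c → ℂ) → (Fin c → ℂ),
      AnalyticAt ℂ Θ 0 ∧ Θ 0 = 0 ∧
      HasFDerivAt Θ (ContinuousLinearMap.snd ℂ _ _ ∘L .snd ℂ _ _) 0 ∧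
      ∀ᶠ q : ((Fin n → ℂ) × (Fin n → ℂ) × (Fin c → ℂ)) × (Fin c → ℂ) in 𝓝 0,
        R (q.1.1, q.1.2.1, q.2, q.1.2.2) = 0 ↔ q.2 = Θ q.1 := by
  let T : ((Fin n → ℂ) × (Fin n → ℂ) × (Fin c → ℂ)) × (Fin c → ℂ) →L[ℂ] CSpace₂ n c :=
    LinearMap.toContinuousLinearMap
    { toFun := fun q => (q.1.1, q.1.2.1, q.2, q.1.2.2)
      map_add' := fun _ _ => rfl
      map_smul' := fun _ _ => rfl }
  -- The factor `2i` makes the partial derivative in `w` the identity, as the implicit function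
  -- theorem above requires.
  suffices h : ∃ Θ : (Fin n → ℂ) × (Fin n → ℂ) × (Fin c → ℂ) → (Fin c → ℂ),
      AnalyticAt ℂ Θ 0 ∧ Θ 0 = 0 ∧
      HasFDerivAt Θ (ContinuousLinearMap.snd ℂ _ _ ∘L .snd ℂ _ _) 0 ∧
      ∀ᶠ q : ((Fin n → ℂ) × (Fin n → ℂ) × (Fin c → ℂ)) × (Fin c → ℂ) in 𝓝 0,
        (2 * Complex.I) • R (T q) = 0 ↔ q.2 = Θ q.1 by
    obtain ⟨Θ, h1, h2, h3, h4⟩ := h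
    refine ⟨Θ, h1, h2, h3, ?_⟩
    filter_upwards [h4] with q hq
    rw [← hq]
    simp [T]
  refine AnalyticAt.exists_implicitFunction (f := fun q => (2 * Complex.I) • R (T q)) ?_ ?_ ?_
  · exact (AnalyticAt.comp_of_eq hR.analytic (T.analyticAt 0)
      (_root_.map_zero T)).fun_const_smul
  · simp [hR.map_zero]
  · have h : HasFDerivAt R (imForm n c) (T 0) := by rw [_root_.map_zero]; exact hR.hasFDerivAt
    refine ((h.comp 0 T.hasFDerivAt).const_smul (2 * Complex.I)).congr_fderiv ?_
    refine ContinuousLinearMap.ext fun q => ?_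
    have : (T q) = (q.1.1, q.1.2.1, q.2, q.1.2.2) := rfl
    simp only [_root_.smul_apply, ContinuousLinearMap.comp_apply, this, imForm_apply]
    rw [smul_inv_smul₀ (by simp)]
    rfl

/-- The graphing function has real coefficients, up to the exchange of `z` and `z̲`. -/
theorem graphing_conj (hR : IsNormalizedEquation R)
    {Φ : (Fin n → ℂ) × (Fin n → ℂ) × (Fin c → ℂ) → (Fin c → ℂ)} (hΦ : AnalyticAt ℂ Φ 0)
    (hΦ0 : Φ 0 = 0)
    (h : ∀ᶠ q : ((Fin n → ℂ) × (Fin n → ℂ) × (Fin c → ℂ)) × (Fin c → ℂ) in 𝓝 0,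
        R (q.1.1, q.1.2.1, q.1.2.2 + Complex.I • q.2, q.1.2.2 - Complex.I • q.2) = 0 ↔
          q.2 = Φ q.1) :
    ∀ᶠ q : (Fin n → ℂ) × (Fin n → ℂ) × (Fin c → ℂ) in 𝓝 0,
      Φ (star q.2.1, star q.1, star q.2.2) = star (Φ q) := by
  have t1 : Tendsto (fun q => (q, Φ q)) (𝓝 0) (𝓝 0) :=
    (continuousAt_id.prodMk hΦ.continuousAt).tendsto_zero (by simp [hΦ0])
  have hs : Continuous fun q : (Fin n → ℂ) × (Fin n → ℂ) × (Fin c → ℂ) =>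
      (star q.2.1, star q.1, star q.2.2) := by fun_prop
  have t2 : Tendsto (fun q => ((star q.2.1, star q.1, star q.2.2), star (Φ q))) (𝓝 0) (𝓝 0) :=
    (hs.continuousAt.prodMk hΦ.continuousAt.star).tendsto_zero (by simp [hΦ0])
  filter_upwards [t1.eventually h, t2.eventually h] with q h1 h2
  -- The conjugate of the solution over `q` solves the equation over the conjugate point; uniqueness
  -- identifies it.
  refine (h2.1 ?_).symm
  have := hR.conj q.1 q.2.1 (q.2.2 + Complex.I • Φ q) (q.2.2 - Complex.I • Φ q)
  rw [h1.2 rfl, star_zero] at this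
  simpa [star_smul, sub_eq_add_neg] using this

end IsNormalizedEquation

/-! ### From the submanifold to a normalized equation -/

section CRGeneric

variable {n c : ℕ}

/-- A real-analytic germ on `ℂⁿ⁺ᶜ` is the restriction to the diagonal of a holomorphic germ. -/
theorem AnalyticAt.exists_polarization {F : Type*} [NormedAddCommGroup F] [NormedSpace ℝ F]
    [NormedSpace ℂ F] [IsScalarTower ℝ ℂ F] [CompleteSpace F] {f : CSpace n c → F}
    (hf : AnalyticAt ℝ f 0) :
    ∃ g : CSpace₂ n c → F, AnalyticAt ℂ g 0 ∧ ∀ᶠ x in 𝓝 0, g (diagonal x) = f x := by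
  let T : ((Fin n ⊕ Fin n) ⊕ (Fin c ⊕ Fin c) → ℝ) →L[ℝ] CSpace n c :=
    LinearMap.toContinuousLinearMap
    { toFun := fun a => (fun k => a (.inl (.inl k)) + Complex.I * a (.inl (.inr k)),
        fun l => a (.inr (.inl l)) + Complex.I * a (.inr (.inr l)))
      map_add' := fun x y => by ext <;> simp <;> ring
      map_smul' := fun r x => by ext <;> simp <;> ring }
  -- The complex-linear extension of the real and imaginary part coordinates: `z̄`, `w̄` become
  -- `z̲`, `w̲`.
  let S : CSpace₂ n c →L[ℂ] ((Fin n ⊕ Fin n) ⊕ (Fin c ⊕ Fin c) → ℂ) :=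
    LinearMap.toContinuousLinearMap
    { toFun := fun x => Sum.elim
        (Sum.elim (fun k => (2 : ℂ)⁻¹ * (x.1 k + x.2.1 k))
          (fun k => (2 * Complex.I)⁻¹ * (x.1 k - x.2.1 k)))
        (Sum.elim (fun l => (2 : ℂ)⁻¹ * (x.2.2.1 l + x.2.2.2 l))
          (fun l => (2 * Complex.I)⁻¹ * (x.2.2.1 l - x.2.2.2 l)))
      map_add' := fun x y => by ext ((_ | _) | (_ | _)) <;> simp <;> ring
      map_smul' := fun r x => by ext ((_ | _) | (_ | _)) <;> simp <;> ring }
  obtain ⟨g, hg, hgf⟩ := (AnalyticAt.comp_of_eq hf (T.analyticAt 0)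
    (map_zero T)).exists_holomorphic_extension
  refine ⟨g ∘ S, AnalyticAt.comp_of_eq hg (S.analyticAt 0) (map_zero S), ?_⟩
  let P : CSpace n c → ((Fin n ⊕ Fin n) ⊕ (Fin c ⊕ Fin c) → ℝ) := fun x => Sum.elim
    (Sum.elim (fun k => (x.1 k).re) (fun k => (x.1 k).im))
    (Sum.elim (fun l => (x.2 l).re) (fun l => (x.2 l).im))
  have hP : Continuous P := by
    refine continuous_pi ?_
    rintro ((_ | _) | (_ | _)) <;> simp only [P, Sum.elim_inl, Sum.elim_inr] <;> fun_prop
  have hP0 : P 0 = 0 := by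
    ext ((_ | _) | (_ | _)) <;> simp [P]
  filter_upwards [(hP.continuousAt.tendsto_zero hP0).eventually hgf] with x hx
  have h1 : S (diagonal x) = fun i => (P x i : ℂ) := by
    ext ((k | k) | (k | k)) <;> simp [S, P, diagonal, Complex.ext_iff] <;> ring
  have h2 : T (P x) = x := by
    ext k <;> simp [T, P, mul_comm Complex.I]
  rw [Function.comp_apply, h1, hx, Function.comp_apply, h2]

/-- The exchange of `z` and `z̲`, and of `w` and `w̲`. -/
noncomputable def swapBar (n c : ℕ) : CSpace₂ n c →L[ℂ] CSpace₂ n c :=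
  LinearMap.toContinuousLinearMap
    { toFun := fun x => (x.2.1, x.1, x.2.2.2, x.2.2.1)
      map_add' := fun _ _ => rfl
      map_smul' := fun _ _ => rfl }

@[simp]
theorem swapBar_apply (x : CSpace₂ n c) : swapBar n c x = (x.2.1, x.1, x.2.2.2, x.2.2.1) := rfl

/-- A real-valued real-analytic germ is the restriction to the diagonal of a holomorphic germ
invariant under the conjugation that fixes the diagonal. -/
theorem AnalyticAt.exists_symmetric_polarization {f : CSpace n c → (Fin c → ℝ)}
    (hf : AnalyticAt ℝ f 0) :
    ∃ R : CSpace₂ n c → (Fin c → ℂ), AnalyticAt ℂ R 0 ∧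
      (∀ z z' w w', R (star z', star z, star w', star w) = star (R (z, z', w, w'))) ∧
      ∀ᶠ x in 𝓝 0, R (diagonal x) = fun l => (f x l : ℂ) := by
  let J : (Fin c → ℝ) →L[ℝ] (Fin c → ℂ) :=
    ContinuousLinearMap.pi fun l => Complex.ofRealCLM ∘L ContinuousLinearMap.proj l
  obtain ⟨g, hg, hgf⟩ := (AnalyticAt.comp (J.analyticAt _) hf).exists_polarization
  -- Averaging over the conjugation forces the symmetry, and changes nothing on the diagonal because
  -- `f` is real there.
  refine ⟨fun x => (2 : ℂ)⁻¹ • (g x + conjSeries g (swapBar n c x)), ?_, ?_, ?_⟩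
  · exact (hg.add (AnalyticAt.comp_of_eq (analyticAt_conjSeries hg) ((swapBar n c).analyticAt 0)
      (map_zero _))).fun_const_smul
  · intro z z' w w'
    simp [conjSeries, star_smul, add_comm, Prod.star_def]
  · filter_upwards [hgf] with x hx
    have h1 : conjSeries g (swapBar n c (diagonal x)) = star (g (diagonal x)) := by
      simp [conjSeries, diagonal, Prod.star_def]
    rw [h1, hx]
    ext l
    simp [J]
    ring

theorem fderiv_apply_eq_zero_of_mem_tangentVectors {E F : Type*} [NormedAddCommGroup E]
    [NormedSpace ℝ E] [NormedAddCommGroup F] [NormedSpace ℝ F] {M U : Set E} {p : E} {ρ : E → F}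
    (hU : U ∈ 𝓝 p) (hρ : DifferentiableAt ℝ ρ p) (hM : ∀ x ∈ U, x ∈ M ↔ ρ x = 0) {v : E}
    (hv : v ∈ tangentVectors M p) : fderiv ℝ ρ p v = 0 := by
  obtain ⟨γ, h0, hγM, hγ⟩ := hv
  have h1 : HasDerivAt (ρ ∘ γ) (fderiv ℝ ρ p v) 0 :=
    HasFDerivAt.comp_hasDerivAt_of_eq 0 hρ.hasFDerivAt hγ h0.symm
  have h2 : ρ ∘ γ =ᶠ[𝓝 0] fun _ => 0 := by
    have hc : ∀ᶠ t in 𝓝 (0 : ℝ), γ t ∈ U := hγ.continuousAt.eventually (by rwa [h0])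
    filter_upwards [hγM, hc] with t h3 h4 using (hM _ h4).1 h3
  exact h1.unique ((hasDerivAt_const (0 : ℝ) (0 : F)).congr_of_eventuallyEq h2)

/-- A germ of submanifold tangent to `{v = 0}` has a defining equation with linear part `v`. -/
theorem exists_defining_im {M : Set (CSpace n c)} (hM : IsRealAnalyticSubmanifold c M)
    (h0 : (0 : CSpace n c) ∈ M)
    (hT : tangentVectors M 0 = {x : CSpace n c | ∀ l, (x.2 l).im = 0}) :
    ∃ f : CSpace n c → (Fin c → ℝ), AnalyticAt ℝ f 0 ∧ f 0 = 0 ∧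
      (∀ x l, fderiv ℝ f 0 x l = (x.2 l).im) ∧ ∀ᶠ x in 𝓝 0, x ∈ M ↔ f x = 0 := by
  obtain ⟨U, ρ, hU, h0U, hρ, hs, hMρ⟩ := hM 0 h0
  have hd : DifferentiableAt ℝ ρ 0 := (hρ 0 h0U).differentiableAt
  let J : (Fin c → ℝ) →ₗ[ℝ] CSpace n c :=
    { toFun := fun v => (0, fun l => Complex.I * v l)
      map_add' := fun x y => by ext <;> simp <;> ring
      map_smul' := fun r x => by ext <;> simp <;> ring }
  -- The differential of `ρ` kills `{v = 0}`, so it factors through `v` as `A`. Being surjective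
  -- between equal dimensions, `A` is invertible, and `A⁻¹ ∘ ρ` has linear part `v`.
  let A : (Fin c → ℝ) →ₗ[ℝ] (Fin c → ℝ) := (fderiv ℝ ρ 0).toLinearMap ∘ₗ J
  have hA : ∀ x, fderiv ℝ ρ 0 x = A fun l => (x.2 l).im := by
    intro x
    have hx : x = (x.1, fun l => ((x.2 l).re : ℂ)) + J fun l => (x.2 l).im := by
      ext l
      · simp [J]
      · simp [J, mul_comm Complex.I]
    have h2 : ((x.1, fun l => ((x.2 l).re : ℂ)) : CSpace n c) ∈ tangentVectors M 0 := by
      rw [hT]; intro l; simp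
    conv_lhs => rw [hx]
    rw [map_add, fderiv_apply_eq_zero_of_mem_tangentVectors (hU.mem_nhds h0U) hd hMρ h2, zero_add]
    rfl
  have hAs : Function.Surjective A := fun y => by
    obtain ⟨x, rfl⟩ := hs 0 h0U y
    exact ⟨_, (hA x).symm⟩
  let e := LinearEquiv.ofBijective A ⟨LinearMap.injective_iff_surjective.2 hAs, hAs⟩
  let B : (Fin c → ℝ) →L[ℝ] (Fin c → ℝ) := LinearMap.toContinuousLinearMap e.symm.toLinearMap
  have hB : ∀ y, B y = e.symm y := fun _ => rfl
  refine ⟨fun x => B (ρ x), AnalyticAt.fun_comp (B.analyticAt _) (hρ 0 h0U), ?_, ?_, ?_⟩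
  · simp only [(hMρ 0 h0U).1 h0, map_zero]
  · intro x l
    have h3 : HasFDerivAt (fun x => B (ρ x)) (B ∘L fderiv ℝ ρ 0) 0 :=
      B.hasFDerivAt.comp 0 hd.hasFDerivAt
    rw [h3.fderiv, ContinuousLinearMap.comp_apply, hA, hB]
    exact congrFun (e.symm_apply_apply fun l => (x.2 l).im) l
  · filter_upwards [hU.mem_nhds h0U] with x hx
    rw [hMρ x hx, hB, LinearEquiv.map_eq_zero_iff]

theorem exists_normalizedEquation {M : Set (CSpace n c)} (hM : IsRealAnalyticSubmanifold c M)
    (h0 : (0 : CSpace n c) ∈ M)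
    (hT : tangentVectors M 0 = {x : CSpace n c | ∀ l, (x.2 l).im = 0}) :
    ∃ R : CSpace₂ n c → (Fin c → ℂ), IsNormalizedEquation R ∧
      ∀ᶠ x in 𝓝 0, x ∈ M ↔ R (diagonal x) = 0 := by
  obtain ⟨f, hf, hf0, hf', hMf⟩ := exists_defining_im hM h0 hT
  obtain ⟨R, hR, hconj, hRf⟩ := hf.exists_symmetric_polarization
  let J : (Fin c → ℝ) →L[ℝ] (Fin c → ℂ) :=
    ContinuousLinearMap.pi fun l => Complex.ofRealCLM ∘L ContinuousLinearMap.proj l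
  let D : CSpace n c →L[ℝ] CSpace₂ n c := LinearMap.toContinuousLinearMap
    { toFun := diagonal
      map_add' := fun x y => by simp [diagonal]
      map_smul' := fun r x => by ext <;> simp [diagonal] }
  have hD : ∀ x, D x = diagonal x := fun _ => rfl
  have hder : ∀ x, fderiv ℂ R 0 (diagonal x) = imForm n c (diagonal x) := by
    intro x
    have h1 : HasFDerivAt (R ∘ D) ((fderiv ℂ R 0).restrictScalars ℝ ∘L D) 0 := by
      refine HasFDerivAt.comp 0 ?_ D.hasFDerivAt
      rw [map_zero]
      exact hR.differentiableAt.hasFDerivAt.restrictScalars ℝ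
    have h2 : HasFDerivAt (fun x => J (f x)) (J ∘L fderiv ℝ f 0) 0 :=
      J.hasFDerivAt.comp 0 hf.differentiableAt.hasFDerivAt
    have h3 := h1.unique (h2.congr_of_eventuallyEq hRf)
    have h4 := DFunLike.congr_fun h3 x
    refine h4.trans ?_
    ext l
    have h5 : x.2 l - star (x.2 l) = 2 * Complex.I * (x.2 l).im := by
      apply Complex.ext <;> simp; ring
    simp only [diagonal, imForm_apply, Pi.smul_apply, Pi.sub_apply, Pi.star_apply, h5, smul_eq_mul]
    rw [inv_mul_cancel_left₀ (by simp)]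
    simp [J, hf']
  refine ⟨R, ⟨hR, ?_, ?_, hconj⟩, ?_⟩
  · have := hRf.self_of_nhds
    rw [hf0] at this
    have h0 : diagonal (0 : CSpace n c) = 0 := by simp [diagonal]
    rw [h0] at this
    rw [this]
    ext; simp
  · refine hR.differentiableAt.hasFDerivAt.congr_fderiv (ContinuousLinearMap.ext fun x => ?_)
    -- The diagonal `D` satisfies `D + iD = ` the whole space, so a complex-linear map is determined
    -- by its values on `D`.
    have hx : x = diagonal ((2 : ℂ)⁻¹ • (x.1 + star x.2.1), (2 : ℂ)⁻¹ • (x.2.2.1 + star x.2.2.2)) +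
        Complex.I • diagonal ((2 * Complex.I)⁻¹ • (x.1 - star x.2.1),
          (2 * Complex.I)⁻¹ • (x.2.2.1 - star x.2.2.2)) := by
      ext l <;> simp [diagonal, Complex.ext_iff] <;> constructor <;> ring
    rw [hx, map_add, map_add, map_smul, map_smul, hder, hder]
  · filter_upwards [hMf, hRf] with x h1 h2
    rw [h1, h2]
    simp [funext_iff]

theorem HasFDerivAt.conjSeries {E F : Type*} [NormedAddCommGroup E] [NormedSpace ℂ E]
    [StarAddMonoid E] [NormedStarGroup E] [StarModule ℂ E] [NormedAddCommGroup F]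
    [NormedSpace ℂ F] [StarAddMonoid F] [NormedStarGroup F] [StarModule ℂ F] {f : E → F}
    {f' f'' : E →L[ℂ] F} (hf : HasFDerivAt f f' 0) (h : ∀ x, f'' x = star (f' (star x))) :
    HasFDerivAt (conjSeries f) f'' 0 := by
  refine .of_isLittleO ?_
  have h1 := hf.isLittleO
  have ht : Tendsto (fun x : E => star x) (𝓝 0) (𝓝 0) := continuous_star.continuousAt.tendsto_zero
    (star_zero E)
  refine ((h1.comp_tendsto ht).norm_norm.congr (fun x => ?_) fun x => ?_).of_norm_norm
  · rw [← norm_star]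
    simp [_root_.conjSeries, h]
  · simp

/-! ### The normalizing change of coordinates -/

/-- In the complexified space, the change of coordinates `w ↦ G(z, w)`, `w̲ ↦ Ḡ(z̲, w̲)`. -/
def complexifiedChange (G : CSpace n c → (Fin c → ℂ)) (x : CSpace₂ n c) : CSpace₂ n c :=
  (x.1, x.2.1, G (x.1, x.2.2.1), conjSeries G (x.2.1, x.2.2.2))

theorem complexifiedChange_diagonal (G : CSpace n c → (Fin c → ℂ)) (x : CSpace n c) :
    complexifiedChange G (diagonal x) = diagonal (x.1, G x) := by
  simp [complexifiedChange, diagonal, conjSeries, Prod.star_def]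

namespace IsNormalizedEquation

variable {R : CSpace₂ n c → (Fin c → ℂ)}

/-- The new coordinate `w'`, such that `w = G(z, w')`, is chosen so that the complexified
submanifold contains the points with `z̲ = 0` and `w' = w̲'`. -/
theorem exists_normalizingChange (hR : IsNormalizedEquation R) :
    ∃ G : CSpace n c → (Fin c → ℂ), AnalyticAt ℂ G 0 ∧ G 0 = 0 ∧
      HasFDerivAt G (.snd ℂ _ _) 0 ∧
      ∀ᶠ x : CSpace n c in 𝓝 0, R (complexifiedChange G (x.1, 0, x.2, x.2)) = 0 := by
  obtain ⟨Φ, hΦ, hΦ0, hΦ', hΦR⟩ := hR.exists_graphing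
  obtain ⟨Θ, hΘ, hΘ0, hΘ', hΘR⟩ := hR.exists_defining
  let T : CSpace n c →L[ℂ] (Fin n → ℂ) × (Fin n → ℂ) × (Fin c → ℂ) :=
    (0 : _ →L[ℂ] (Fin n → ℂ)).prod ((0 : _ →L[ℂ] (Fin n → ℂ)).prod (.snd ℂ _ _))
  have hT : ∀ x, T x = (0, 0, x.2) := fun _ => rfl
  have hT0 : T 0 = 0 := _root_.map_zero T
  have hΦT : AnalyticAt ℂ (Φ ∘ T) 0 := AnalyticAt.comp_of_eq hΦ (T.analyticAt 0) hT0
  have hΦT' : HasFDerivAt (Φ ∘ T) (0 : CSpace n c →L[ℂ] (Fin c → ℂ)) 0 := by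
    have : HasFDerivAt Φ (0 : _ →L[ℂ] (Fin c → ℂ)) (T 0) := by rwa [hT0]
    simpa using this.comp 0 T.hasFDerivAt
  -- The point where `Θ` is evaluated: `z̲ = 0`, and `w̲` is that of the slice point with parameter
  -- `ν = x.2`.
  let S : CSpace n c → (Fin n → ℂ) × (Fin n → ℂ) × (Fin c → ℂ) := fun x =>
    (x.1, 0, x.2 - Complex.I • (Φ ∘ T) x)
  have hS0 : S 0 = 0 := by simp [S, hΦ0]
  have hS : AnalyticAt ℂ S 0 :=
    analyticAt_fst.prod (analyticAt_const.prod (analyticAt_snd.sub hΦT.fun_const_smul))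
  have hS' : HasFDerivAt S ((ContinuousLinearMap.fst ℂ _ _).prod
      ((0 : CSpace n c →L[ℂ] (Fin n → ℂ)).prod (.snd ℂ _ _ - Complex.I • 0))) 0 :=
    hasFDerivAt_fst.prodMk ((hasFDerivAt_const _ _).prodMk
      (hasFDerivAt_snd.sub (hΦT'.const_smul Complex.I)))
  refine ⟨Θ ∘ S, AnalyticAt.comp_of_eq hΘ hS hS0, by simp [hS0, hΘ0], ?_, ?_⟩
  · have : HasFDerivAt Θ (ContinuousLinearMap.snd ℂ _ _ ∘L .snd ℂ _ _) (S 0) := by rwa [hS0]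
    refine (this.comp 0 hS').congr_fderiv ?_
    ext <;> simp
  · have t1 : Tendsto (fun x => (T x, Φ (T x))) (𝓝 0) (𝓝 0) :=
      (T.continuous.continuousAt.prodMk hΦT.continuousAt).tendsto_zero (by simp [hT0, hΦ0])
    have t2 : Tendsto (fun x => ((0, 0, x.2 - Complex.I • Φ (T x)), x.2 + Complex.I • Φ (T x)) :
        CSpace n c → ((Fin n → ℂ) × (Fin n → ℂ) × (Fin c → ℂ)) × (Fin c → ℂ)) (𝓝 0) (𝓝 0) := by
      have h := hΦT.continuousAt.const_smul Complex.I
      refine ContinuousAt.tendsto_zero ?_ (by simp [hT0, hΦ0])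
      exact (continuousAt_const.prodMk (continuousAt_const.prodMk
        (continuousAt_snd.sub h))).prodMk (continuousAt_snd.add h)
    have t3 : Tendsto (fun x => (S x, Θ (S x))) (𝓝 0) (𝓝 0) :=
      (hS.continuousAt.prodMk (hΘ.continuousAt.comp_of_eq hS.continuousAt hS0)).tendsto_zero
        (by simp [hS0, hΘ0])
    have ts : Tendsto (fun x : CSpace n c => ((0, star x.2) : CSpace n c)) (𝓝 0) (𝓝 0) :=
      ContinuousAt.tendsto_zero (by fun_prop) (by simp)
    have tT : Tendsto T (𝓝 0) (𝓝 0) := T.continuous.continuousAt.tendsto_zero hT0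
    -- At `z = 0`, solving for `w` recovers the slice point, by uniqueness.
    have h1 : ∀ᶠ x in 𝓝 0, Θ (S (0, x.2)) = x.2 + Complex.I • Φ (T x) := by
      filter_upwards [t1.eventually hΦR, t2.eventually hΘR] with x h2 h3
      exact (h3.1 (h2.2 rfl)).symm
    filter_upwards [t3.eventually hΘR, ts.eventually h1,
      tT.eventually (hR.graphing_conj hΦ hΦ0 hΦR)] with x h2 h3 h4
    -- Conjugation only flips the sign of `i`, since `Φ(0,0,·)` has real coefficients.
    have h5 : conjSeries (Θ ∘ S) (0, x.2) = x.2 - Complex.I • Φ (T x) := by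
      simp only [hT, star_zero] at h4
      simp only [conjSeries, Function.comp_apply, Prod.star_def, star_zero, h3, hT, h4]
      simp [star_smul, sub_eq_add_neg]
    simp only [complexifiedChange, h5]
    exact h2.2 rfl

/-- The change has derivative the identity at the origin, which keeps the linear part; using `Ḡ` on
the barred variables makes it commute with the conjugation. -/
theorem comp_complexifiedChange (hR : IsNormalizedEquation R) {G : CSpace n c → (Fin c → ℂ)}
    (hG : AnalyticAt ℂ G 0) (hG0 : G 0 = 0) (hG' : HasFDerivAt G (.snd ℂ _ _) 0) :
    IsNormalizedEquation (R ∘ complexifiedChange G) := by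
  let P : CSpace₂ n c →L[ℂ] CSpace n c :=
    (ContinuousLinearMap.fst ℂ _ _).prod
      (ContinuousLinearMap.fst ℂ _ _ ∘L .snd ℂ _ _ ∘L .snd ℂ _ _)
  let Q : CSpace₂ n c →L[ℂ] CSpace n c :=
    (ContinuousLinearMap.fst ℂ _ _ ∘L .snd ℂ _ _).prod
      (ContinuousLinearMap.snd ℂ _ _ ∘L .snd ℂ _ _ ∘L .snd ℂ _ _)
  have hcG := analyticAt_conjSeries hG
  have hcG' : HasFDerivAt (conjSeries G) (.snd ℂ _ _) 0 := hG'.conjSeries fun x => by simp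
  have hcG0 : conjSeries G 0 = 0 := by simp [conjSeries, hG0]
  have h0 : complexifiedChange G 0 = 0 :=
    Prod.ext rfl (Prod.ext rfl (Prod.ext hG0 hcG0))
  have hGP : AnalyticAt ℂ (G ∘ P) 0 :=
    AnalyticAt.comp_of_eq hG (P.analyticAt 0) (_root_.map_zero P)
  have hcGQ : AnalyticAt ℂ (conjSeries G ∘ Q) 0 :=
    AnalyticAt.comp_of_eq hcG (Q.analyticAt 0) (_root_.map_zero Q)
  have hK : AnalyticAt ℂ (complexifiedChange G) 0 :=
    analyticAt_fst.prod ((analyticAt_fst.comp analyticAt_snd).prod (hGP.prod hcGQ))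
  have hP' : HasFDerivAt (G ∘ P) (.snd ℂ _ _ ∘L P) 0 := by
    refine HasFDerivAt.comp 0 ?_ P.hasFDerivAt
    rwa [_root_.map_zero]
  have hQ' : HasFDerivAt (conjSeries G ∘ Q) (.snd ℂ _ _ ∘L Q) 0 := by
    refine HasFDerivAt.comp 0 ?_ Q.hasFDerivAt
    rwa [_root_.map_zero]
  have hK' : HasFDerivAt (complexifiedChange G) (.id ℂ _) 0 :=
    hasFDerivAt_fst.prodMk
      ((hasFDerivAt_fst.comp (0 : CSpace₂ n c) hasFDerivAt_snd).prodMk (hP'.prodMk hQ'))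
  refine ⟨AnalyticAt.comp_of_eq hR.analytic hK h0, by simp [h0, hR.map_zero], ?_, ?_⟩
  · have : HasFDerivAt R (imForm n c) (complexifiedChange G 0) := by
      rw [h0]; exact hR.hasFDerivAt
    simpa using this.comp 0 hK'
  · intro z z' w w'
    simp only [Function.comp_apply, complexifiedChange]
    rw [← hR.conj]
    simp [conjSeries, Prod.star_def]

/-! ### Reading off the normal form -/

/-- A normalized equation satisfied by the points with `z̲ = 0` and `w = w̲` has graphing and
complex defining functions in normal form. -/
theorem exists_normalForm (hR : IsNormalizedEquation R)
    (hz : ∀ᶠ x : CSpace n c in 𝓝 0, R (x.1, 0, x.2, x.2) = 0) {M : Set (CSpace n c)}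
    (hM : ∀ᶠ x in 𝓝 0, x ∈ M ↔ R (diagonal x) = 0) :
    ∃ (φ : (Fin n → ℂ) × (Fin c → ℝ) → (Fin c → ℝ))
      (Φ Θ : (Fin n → ℂ) × (Fin n → ℂ) × (Fin c → ℂ) → (Fin c → ℂ)),
      IsGraphingFunction M φ ∧ IsComplexification φ Φ ∧
      IsComplexDefiningFunction Φ Θ ∧
      (∀ᶠ x : CSpace n c in 𝓝 0, x ∈ M ↔ x.2 = Θ (x.1, star x.1, star x.2)) ∧
      (∀ᶠ q : (Fin n → ℂ) × (Fin c → ℂ) in 𝓝 0, Φ (q.1, 0, q.2) = 0) ∧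
      (∀ᶠ q : (Fin n → ℂ) × (Fin c → ℂ) in 𝓝 0, Φ (0, q.1, q.2) = 0) ∧
      (∀ᶠ q : (Fin n → ℂ) × (Fin c → ℂ) in 𝓝 0, Θ (0, q.1, q.2) = q.2) ∧
      (∀ᶠ q : (Fin n → ℂ) × (Fin c → ℂ) in 𝓝 0, Θ (q.1, 0, q.2) = q.2) ∧
      (∀ᶠ q : (Fin n → ℂ) × (Fin c → ℂ) in 𝓝 0, conjSeries Θ (0, q.1, q.2) = q.2) ∧
      (∀ᶠ q : (Fin n → ℂ) × (Fin c → ℂ) in 𝓝 0, conjSeries Θ (q.1, 0, q.2) = q.2) := by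
  obtain ⟨Φ, hΦ, hΦ0, -, hΦR⟩ := hR.exists_graphing
  obtain ⟨Θ, hΘ, hΘ0, -, hΘR⟩ := hR.exists_defining
  have tstar : Tendsto (fun x : CSpace n c => star x) (𝓝 0) (𝓝 0) :=
    continuous_star.continuousAt.tendsto_zero (star_zero _)
  have hz' : ∀ᶠ x : CSpace n c in 𝓝 0, R (0, x.1, x.2, x.2) = 0 := by
    filter_upwards [tstar.eventually hz] with x hx
    have := hR.conj (star x.1) 0 (star x.2) (star x.2)
    simp only [Prod.fst_star, Prod.snd_star] at hx
    simpa [hx] using this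
  let T : (Fin n → ℂ) × (Fin c → ℝ) →L[ℝ] (Fin n → ℂ) × (Fin n → ℂ) × (Fin c → ℂ) :=
    LinearMap.toContinuousLinearMap
    { toFun := fun q => (q.1, star q.1, fun l => (q.2 l : ℂ))
      map_add' := fun x y => by ext <;> simp
      map_smul' := fun r x => by ext <;> simp }
  have hT : ∀ q, T q = (q.1, star q.1, fun l => (q.2 l : ℂ)) := fun _ => rfl
  have tT : Tendsto T (𝓝 0) (𝓝 0) := T.continuous.continuousAt.tendsto_zero (_root_.map_zero T)
  let reL : (Fin c → ℂ) →L[ℝ] (Fin c → ℝ) :=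
    ContinuousLinearMap.pi fun l => Complex.reCLM ∘L ContinuousLinearMap.proj l
  -- Points with `z̲ = z̄` and real `ν` are fixed by the conjugation, so `Φ` is real there.
  have hreal : ∀ᶠ q in 𝓝 0, Φ (T q) = fun l => ((reL (Φ (T q)) l : ℝ) : ℂ) := by
    filter_upwards [tT.eventually (hR.graphing_conj hΦ hΦ0 hΦR)] with q hq
    have h1 : star (fun l => (q.2 l : ℂ)) = fun l => (q.2 l : ℂ) := by ext; simp
    simp only [hT, star_star, h1] at hq
    ext l
    exact (Complex.conj_eq_iff_re.1 (congrFun hq l).symm).symm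
  have tri : Tendsto (fun x : CSpace n c => ((x.1, fun l => (x.2 l).re) :
      (Fin n → ℂ) × (Fin c → ℝ))) (𝓝 0) (𝓝 0) :=
    ContinuousAt.tendsto_zero (by fun_prop) (by ext <;> simp)
  refine ⟨fun q => reL (Φ (T q)), Φ, Θ, ⟨?_, ?_, ?_⟩, ⟨hΦ, hreal⟩, ⟨hΘ, hΘ0, ?_⟩, ?_, ?_, ?_,
    ?_⟩
  · exact AnalyticAt.fun_comp (reL.analyticAt _)
      (AnalyticAt.comp_of_eq hΦ.restrictScalars (T.analyticAt 0) (_root_.map_zero T))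
  · simp [hΦ0]
  · have t : Tendsto (fun x : CSpace n c => ((T (x.1, fun l => (x.2 l).re),
        fun l => ((x.2 l).im : ℂ)))) (𝓝 0) (𝓝 0) :=
      ContinuousAt.tendsto_zero (by fun_prop) (by
        refine Prod.ext ((congrArg T ?_).trans (_root_.map_zero T)) ?_ <;> ext <;> simp)
    filter_upwards [hM, t.eventually hΦR, tri.eventually hreal] with x h1 h2 h3
    have h4 : (fun l => ((x.2 l).re : ℂ)) + Complex.I • (fun l => ((x.2 l).im : ℂ)) = x.2 := by
      ext l; simp [mul_comm Complex.I]
    have h5 : (fun l => ((x.2 l).re : ℂ)) - Complex.I • (fun l => ((x.2 l).im : ℂ)) = star x.2 := by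
      ext l; apply Complex.ext <;> simp
    rw [h3] at h2
    simp only [hT, h4, h5] at h2
    rw [h1, diagonal, h2]
    simp [funext_iff, hT]
  · have t : Tendsto (fun q => ((q.1, q.2.1, (2 : ℂ)⁻¹ • (Θ q + q.2.2)),
        (2 * Complex.I)⁻¹ • (Θ q - q.2.2))) (𝓝 0) (𝓝 0) := by
      have := hΘ.continuousAt
      exact ContinuousAt.tendsto_zero (by fun_prop) (by simp [hΘ0])
    have t' : Tendsto (fun q => (q, Θ q)) (𝓝 0) (𝓝 0) :=
      (continuousAt_id.prodMk hΘ.continuousAt).tendsto_zero (by simp [hΘ0])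
    filter_upwards [t.eventually hΦR, t'.eventually hΘR] with q h1 h2
    refine h1.1 ?_
    rw [← h2.2 rfl]
    have hI : Complex.I * (2 * Complex.I)⁻¹ = 2⁻¹ := by field_simp
    rw [smul_smul, hI]
    congr 4 <;> module
  · have t : Tendsto (fun x : CSpace n c => ((x.1, star x.1, star x.2), x.2)) (𝓝 0) (𝓝 0) :=
      ContinuousAt.tendsto_zero (by fun_prop) (by simp)
    filter_upwards [hM, t.eventually hΘR] with x h1 h2
    rw [h1, ← h2]
    rfl
  · have t : Tendsto (fun x : CSpace n c => ((x.1, (0 : Fin n → ℂ), x.2), (0 : Fin c → ℂ)))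
      (𝓝 0) (𝓝 0) := ContinuousAt.tendsto_zero (by fun_prop) (by simp)
    filter_upwards [hz, t.eventually hΦR] with x h1 h2
    exact (h2.1 (by simpa using h1)).symm
  · have t : Tendsto (fun x : CSpace n c => (((0 : Fin n → ℂ), x.1, x.2), (0 : Fin c → ℂ)))
      (𝓝 0) (𝓝 0) := ContinuousAt.tendsto_zero (by fun_prop) (by simp)
    filter_upwards [hz', t.eventually hΦR] with x h1 h2
    exact (h2.1 (by simpa using h1)).symm
  · have t1 : Tendsto (fun x : CSpace n c => ((x.1, (0 : Fin n → ℂ), x.2), x.2))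
      (𝓝 0) (𝓝 0) := ContinuousAt.tendsto_zero (by fun_prop) (by simp)
    have t2 : Tendsto (fun x : CSpace n c => (((0 : Fin n → ℂ), x.1, x.2), x.2))
      (𝓝 0) (𝓝 0) := ContinuousAt.tendsto_zero (by fun_prop) (by simp)
    have hΘ1 : ∀ᶠ q : CSpace n c in 𝓝 0, Θ (q.1, 0, q.2) = q.2 := by
      filter_upwards [hz, t1.eventually hΘR] with x h1 h2 using (h2.1 h1).symm
    have hΘ2 : ∀ᶠ q : CSpace n c in 𝓝 0, Θ (0, q.1, q.2) = q.2 := by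
      filter_upwards [hz', t2.eventually hΘR] with x h1 h2 using (h2.1 h1).symm
    refine ⟨hΘ2, hΘ1, ?_, ?_⟩
    · filter_upwards [tstar.eventually hΘ2] with x hx
      simp only [Prod.fst_star, Prod.snd_star] at hx
      simp [conjSeries, Prod.star_def, hx]
    · filter_upwards [tstar.eventually hΘ1] with x hx
      simp only [Prod.fst_star, Prod.snd_star] at hx
      simp [conjSeries, Prod.star_def, hx]

end IsNormalizedEquation

/-! ### The biholomorphism and the conclusion -/

/-- A holomorphic germ with derivative the identity is a local biholomorphism. -/
theorem AnalyticAt.exists_localBiholomorphism {E : Type*} [NormedAddCommGroup E] [NormedSpace ℂ E]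
    [CompleteSpace E] {F : E → E} (hF : AnalyticAt ℂ F 0) (hF0 : F 0 = 0)
    (hF' : HasFDerivAt F (.id ℂ E) 0) :
    ∃ h : OpenPartialHomeomorph E E, IsLocalBiholomorphismAtZero h ∧ ∀ x, h.symm x = F x := by
  have hs : HasStrictFDerivAt F (ContinuousLinearEquiv.refl ℂ E : E →L[ℂ] E) 0 := by
    have := hF.hasStrictFDerivAt
    rwa [hF'.fderiv] at this
  let e := hs.toOpenPartialHomeomorph F
  have he : ∀ x, e x = F x := fun _ => rfl
  have h0 : (0 : E) ∈ e.source := hs.mem_toOpenPartialHomeomorph_source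
  have hsymm : AnalyticAt ℂ e.symm 0 := by
    have : AnalyticAt ℂ e.symm (e 0) :=
      e.analyticAt_symm' (i := ContinuousLinearEquiv.refl ℂ E) h0 hF hF'.fderiv
    rwa [he, hF0] at this
  obtain ⟨U, hU, hUo, h0U⟩ := eventually_nhds_iff.1 hF.eventually_analyticAt
  obtain ⟨W, hW, hWo, h0W⟩ := eventually_nhds_iff.1 hsymm.eventually_analyticAt
  -- Two restrictions, one on each side, make both `F` and its inverse holomorphic on the entire
  -- domains; `e₂` is the inverse direction.
  let e₁ := e.restrOpen U hUo
  let e₂ := e₁.symm.restrOpen W hWo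
  have hsub : e₂.source ⊆ W := fun x hx => hx.2
  have hsub' : e₂.target ⊆ U := fun x hx => by
    have := e₂.map_target hx
    have h2 : e₂ (e₂.symm x) ∈ e₁.source := e₁.map_target this.1
    rw [e₂.right_inv hx] at h2
    exact h2.2
  have h0e : e.symm 0 = 0 := by
    have := e.left_inv h0
    rwa [he, hF0] at this
  refine ⟨e₂, ⟨⟨?_, h0W⟩, h0e, fun x hx => (hW x (hsub hx)).differentiableAt.differentiableWithinAt,
    fun x hx => (hU x (hsub' hx)).differentiableAt.differentiableWithinAt⟩, fun x => rfl⟩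
  have h1 : (0 : E) ∈ e₁.source := ⟨h0, h0U⟩
  have h2 := e₁.map_source h1
  have h3 : e₁ 0 = 0 := hF0
  rwa [h3] at h2

end CRGeneric

theorem mainTheorem1 (n c : ℕ) (hn : 1 ≤ n) (hc : 1 ≤ c)
    (M : Set (CSpace n c)) (hM : IsCRGeneric M) (h0 : (0 : CSpace n c) ∈ M)
    (hT : tangentVectors M 0 = {x : CSpace n c | ∀ l, (x.2 l).im = 0}) :
    ∃ (h : OpenPartialHomeomorph (CSpace n c) (CSpace n c))
      (φ : (Fin n → ℂ) × (Fin c → ℝ) → (Fin c → ℝ))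
      (Φ Θ : (Fin n → ℂ) × (Fin n → ℂ) × (Fin c → ℂ) → (Fin c → ℂ)),
      -- the local biholomorphism, `z ↦ z`, `w ↦ w(z, w)`
      IsLocalBiholomorphismAtZero h ∧ (∀ x ∈ h.source, (h x).1 = x.1) ∧
      -- the new graphing function, its complexification, the new complex defining function
      IsGraphingFunction (h '' (M ∩ h.source)) φ ∧ IsComplexification φ Φ ∧
      IsComplexDefiningFunction Φ Θ ∧
      (∀ᶠ x : CSpace n c in 𝓝 0,
        x ∈ h '' (M ∩ h.source) ↔ x.2 = Θ (x.1, star x.1, star x.2)) ∧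
      -- normalization of the graphing function
      (∀ᶠ q : (Fin n → ℂ) × (Fin c → ℂ) in 𝓝 0, Φ (q.1, 0, q.2) = 0) ∧
      (∀ᶠ q : (Fin n → ℂ) × (Fin c → ℂ) in 𝓝 0, Φ (0, q.1, q.2) = 0) ∧
      -- normalization of the complex defining function and of its conjugate
      (∀ᶠ q : (Fin n → ℂ) × (Fin c → ℂ) in 𝓝 0, Θ (0, q.1, q.2) = q.2) ∧
      (∀ᶠ q : (Fin n → ℂ) × (Fin c → ℂ) in 𝓝 0, Θ (q.1, 0, q.2) = q.2) ∧
      (∀ᶠ q : (Fin n → ℂ) × (Fin c → ℂ) in 𝓝 0, conjSeries Θ (0, q.1, q.2) = q.2) ∧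
      (∀ᶠ q : (Fin n → ℂ) × (Fin c → ℂ) in 𝓝 0, conjSeries Θ (q.1, 0, q.2) = q.2) := by
  obtain ⟨R, hR, hMR⟩ := exists_normalizedEquation hM.submanifold h0 hT
  obtain ⟨G, hG, hG0, hG', hGR⟩ := hR.exists_normalizingChange
  have hF0 : ((0 : CSpace n c).1, G 0) = 0 := by simp [hG0]
  have hF : AnalyticAt ℂ (fun x : CSpace n c => (x.1, G x)) 0 := analyticAt_fst.prod hG
  obtain ⟨h, hh, hsymm⟩ := hF.exists_localBiholomorphism hF0 (hasFDerivAt_fst.prodMk hG')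
  -- Since `h.symm` is `(z, w) ↦ (z, G(z, w))`, the image of `M` is cut out by pulling `R` back
  -- along it.
  have hM' : ∀ᶠ x in 𝓝 0,
      x ∈ h '' (M ∩ h.source) ↔ (R ∘ complexifiedChange G) (diagonal x) = 0 := by
    have h0t : (0 : CSpace n c) ∈ h.target := by
      have := h.map_source hh.zero_mem
      rwa [hh.map_zero] at this
    filter_upwards [h.open_target.mem_nhds h0t,
      (hF.continuousAt.tendsto_zero hF0).eventually hMR] with x hx h2
    rw [Function.comp_apply, complexifiedChange_diagonal, ← h2, ← hsymm]
    constructor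
    · rintro ⟨y, ⟨hy, hys⟩, rfl⟩
      rwa [h.left_inv hys]
    · exact fun hx' => ⟨_, ⟨hx', h.map_target hx⟩, h.right_inv hx⟩
  obtain ⟨φ, Φ, Θ, H⟩ := (hR.comp_complexifiedChange hG hG0 hG').exists_normalForm hGR hM'
  refine ⟨h, φ, Φ, Θ, hh, fun x hx => ?_, H⟩
  have := hsymm (h x)
  rw [h.left_inv hx] at this
  exact (congrArg Prod.fst this).symm
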